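/- A half-plane is a set of the form $\{x\in\mathbb{R}^2 : \langle a,x\rangle\ge b\}$ (closed) or $\{x\in\mathbb{R}^2 : \langle a,x\rangle> b\}$ (open) with $a\in\mathbb{R}^2\setminus\{0\}$ and $b\in\mathbb{R}$. For an integer $k\ge 1$, let $\bar f_{\mathcal H}(k)$ denote the minimum number $m$ such that every finite set $H$ of half-planes admits a $k$-coloring $\chi:H\to\{1,\dots,k\}$ with the following property: for every point $p\in\mathbb{R}^2$ that is contained in at least $m$ half-planes of $H$ and every color $i\in\{1,\dots,k\}$, some half-plane of $H$ of color $i$ contains $p$ (with $\bar f_{\mathcal H}(k)=\infty$ if there is no such $m$). Theorem. For every integer $k\ge 1$, $\bar f_{\mathcal H}(k)\le 3k-2$. Equivalently, every finite set of half-planes can be $k$-colored so that any point covered by at least $3k-2$ of them is covered by a half-plane of every color. -/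

import Mathlib

/-- The Euclidean plane. -/
abbrev Plane : Type := EuclideanSpace ℝ (Fin 2)

/-- A (closed or open) half-plane: one of the two sides of a line, with or without the line. -/
def IsHalfPlane (h : Set Plane) : Prop :=
  ∃ (a : Plane) (b : ℝ), a ≠ 0 ∧ (h = {x | b ≤ inner ℝ a x} ∨ h = {x | b < inner ℝ a x})

/-- The family of all half-planes. -/
def halfPlanes : Set (Set Plane) := {h | IsHalfPlane h}

/-- A set of vertices is polychromatic for a `k`-coloring if it meets every color class. -/
def IsPolychromatic {V : Type*} {k : ℕ} (χ : V → Fin k) (S : Set V) : Prop :=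
  ∀ i : Fin k, (S ∩ χ ⁻¹' {i}).Nonempty

/-- The members of the finite family `F` that contain the point `p`. -/
def coveringAt {X : Type*} (F : Finset (Set X)) (p : X) : Set ↥F :=
  {R | p ∈ (R : Set X)}

/-- Every finite sub-family of `𝓡` has a `k`-coloring for which, at each point contained in at
least `m` of its members, the members containing that point are polychromatic. -/
def IsCoverThreshold {X : Type*} (𝓡 : Set (Set X)) (k m : ℕ) : Prop :=
  ∀ F : Finset (Set X), (F : Set (Set X)) ⊆ 𝓡 →
    ∃ χ : ↥F → Fin k, ∀ p : X,
      m ≤ (coveringAt F p).ncard → IsPolychromatic χ (coveringAt F p)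

/-- The least `m` such that `IsCoverThreshold 𝓡 k m`, which is `⊤` when there is none. -/
noncomputable def fBar {X : Type*} (𝓡 : Set (Set X)) (k : ℕ) : ℕ∞ :=
  ⨅ m ∈ {m : ℕ | IsCoverThreshold 𝓡 k m}, (m : ℕ∞)

/-- The bound `fBar 𝓡 k ≤ m` says exactly that `m` itself has the defining property. -/
theorem fBar_le_iff {X : Type*} (𝓡 : Set (Set X)) (k m : ℕ) :
    fBar 𝓡 k ≤ (m : ℕ∞) ↔ IsCoverThreshold 𝓡 k m := by
  constructor
  · intro h
    have h1 : fBar 𝓡 k < ((m + 1 : ℕ) : ℕ∞) :=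
      lt_of_le_of_lt h (by exact_mod_cast Nat.lt_succ_self m)
    simp only [fBar, iInf_lt_iff] at h1
    obtain ⟨n, hn, hlt⟩ := h1
    have hnm : n ≤ m := Nat.lt_succ_iff.mp (by exact_mod_cast hlt)
    intro F hF
    obtain ⟨χ, hχ⟩ := hn F hF
    exact ⟨χ, fun p hp => hχ p (hnm.trans hp)⟩
  · intro h
    exact iInf₂_le (f := fun (n : ℕ) (_ : n ∈ {n : ℕ | IsCoverThreshold 𝓡 k n}) => (n : ℕ∞)) m h

/-!
The half-plane `⟪a, x⟫ + c > 0` is the vector `(a, c)` of `ℝ² × ℝ`, and a point is a linear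
functional that is positive exactly on the half-planes containing it. Only finitely many points
matter, so the vectors may be perturbed into general position. The colors are then assigned one at
a time: each goes to a set that meets every inclusion-minimal remaining trace of large size, and
that takes at most three elements away from it.

If `0` is in the convex hull of the remaining vectors, Carathéodory's theorem gives four of them
that positively span the space, and no functional is positive on all four. Otherwise the vectors
lie in an open half-space; those that can be isolated by a functional (the extreme points, after
rescaling) meet every nonempty trace, and a minimal hitting set of such vectors meets each minimal
trace at most twice. Indeed, given three of them in a minimal trace `A`, every vector outside `A`
has in the basis formed by these three exactly one negative coordinate, the same one for all vectors
by convexity. The basis vector at this coordinate cannot be the only element of the hitting set in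
a minimal trace `A'`, for `A'` would be contained in `A` and so equal to it; hence it is redundant.
-/

open Module

section Hypergraph

variable {ι : Type*}

/-- The shallow hitting sets of the literature: `S` meets every member of `𝓗` in at least one and
at most `c` elements. -/
def IsShallowHittingSet (c : ℕ) (𝓗 : Set (Set ι)) (S : Set ι) : Prop :=
  ∀ A ∈ 𝓗, (S ∩ A).Nonempty ∧ (S ∩ A).ncard ≤ c

/-- The inclusion-minimal sets among the traces `V ∩ R`, `R ∈ 𝓡`, with at least `m` elements: a
coloring that is polychromatic on these is polychromatic on all traces with at least `m` elements.
For infinite traces `Set.ncard` is `0`, so this is meant for finite `V`. -/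
def minimalTraces (𝓡 : Set (Set ι)) (V : Set ι) (m : ℕ) : Set (Set ι) :=
  {A | Minimal (fun B => B ∈ (V ∩ ·) '' 𝓡 ∧ m ≤ B.ncard) A}

theorem mem_minimalTraces {𝓡 : Set (Set ι)} {V A : Set ι} {m : ℕ} :
    A ∈ minimalTraces 𝓡 V m ↔ Minimal (fun B => B ∈ (V ∩ ·) '' 𝓡 ∧ m ≤ B.ncard) A :=
  Iff.rfl

theorem exists_minimalTraces_subset [Finite ι] {𝓡 : Set (Set ι)} {V R : Set ι} {m : ℕ}
    (hR : R ∈ 𝓡) (hm : m ≤ (V ∩ R).ncard) : ∃ A ∈ minimalTraces 𝓡 V m, A ⊆ V ∩ R := by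
  obtain ⟨A, hAR, hA⟩ := exists_minimal_le_of_wellFoundedLT
    (fun B => B ∈ (V ∩ ·) '' 𝓡 ∧ m ≤ B.ncard) (V ∩ R) ⟨⟨R, hR, rfl⟩, hm⟩
  exact ⟨A, hA, hAR⟩

theorem exists_subset_hitting_with_private_members [Finite ι] {𝓗 : Set (Set ι)} {T : Set ι}
    (hT : ∀ A ∈ 𝓗, (T ∩ A).Nonempty) :
    ∃ S ⊆ T, (∀ A ∈ 𝓗, (S ∩ A).Nonempty) ∧ ∀ s ∈ S, ∃ A ∈ 𝓗, S ∩ A = {s} := by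
  obtain ⟨S, hST, hS⟩ := exists_minimal_le_of_wellFoundedLT
    (fun S : Set ι => ∀ A ∈ 𝓗, (S ∩ A).Nonempty) T hT
  refine ⟨S, hST, hS.prop, fun s hs => ?_⟩
  obtain ⟨A, hA, hempty⟩ : ∃ A ∈ 𝓗, (S \ {s}) ∩ A = ∅ := by
    by_contra! hhit
    exact (hS.le_of_le hhit Set.sdiff_subset hs).2 rfl
  have honly : ∀ t ∈ S ∩ A, t = s := fun t ht => by
    by_contra hne
    exact Set.eq_empty_iff_forall_notMem.mp hempty t ⟨⟨ht.1, hne⟩, ht.2⟩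
  exact ⟨A, hA, Set.eq_singleton_iff_nonempty_unique_mem.mpr ⟨hS.prop A hA, honly⟩⟩

/-- Give one color to a shallow hitting set of the minimal traces of size `c * k + 1`; each of them
keeps at least `c * (k - 1) + 1` elements for the remaining colors. -/
theorem exists_isPolychromatic_of_isShallowHittingSet [Finite ι] {𝓡 : Set (Set ι)} {c : ℕ}
    (h : ∀ (V : Set ι) (m : ℕ), 1 ≤ m → ∃ S, IsShallowHittingSet c (minimalTraces 𝓡 V m) S)
    (k : ℕ) (V : Set ι) :
    ∃ χ : ι → Fin (k + 1), ∀ R ∈ 𝓡, c * k + 1 ≤ (V ∩ R).ncard → IsPolychromatic χ (V ∩ R) := by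
  classical
  induction k generalizing V with
  | zero =>
    refine ⟨fun _ => 0, fun R _ hcard i => ?_⟩
    obtain ⟨x, hx⟩ := Set.nonempty_of_ncard_ne_zero (s := V ∩ R) (by omega)
    exact ⟨x, hx, Subsingleton.elim (α := Fin 1) _ _⟩
  | succ k ih =>
    obtain ⟨S, hS⟩ := h V (c * (k + 1) + 1) (by omega)
    obtain ⟨χ, hχ⟩ := ih (V \ S)
    refine ⟨fun x => if x ∈ S then Fin.last _ else (χ x).castSucc, fun R hR hcard => ?_⟩
    obtain ⟨A, hA, hAR⟩ := exists_minimalTraces_subset hR hcard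
    obtain ⟨⟨R', hR', rfl⟩, hm : c * (k + 1) + 1 ≤ (V ∩ R').ncard⟩ := (mem_minimalTraces.mp hA).prop
    obtain ⟨⟨s, hsS, hsA⟩, hshallow : (S ∩ (V ∩ R')).ncard ≤ c⟩ := hS _ hA
    refine Fin.lastCases ⟨s, hAR hsA, by simp [hsS]⟩ fun i => ?_
    have hcover : V ∩ R' ⊆ (V \ S) ∩ R' ∪ S ∩ (V ∩ R') := fun x hx => by
      by_cases hxS : x ∈ S <;> simp [hx.1, hx.2, hxS]
    have hcard' := (Set.ncard_le_ncard hcover).trans (Set.ncard_union_le _ _)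
    have hrest : c * k + 1 ≤ ((V \ S) ∩ R').ncard := by
      rw [mul_add_one] at hm
      omega
    obtain ⟨x, ⟨⟨hxV, hxS⟩, hxR'⟩, hxi⟩ := hχ R' hR' hrest i
    exact ⟨x, hAR ⟨hxV, hxR'⟩, by simpa [hxS] using hxi⟩

end Hypergraph

section GeneralPosition

variable {ι κ E : Type*} [NormedAddCommGroup E] [NormedSpace ℝ E]

theorem dense_setOf_linearIndependent [Fintype κ] [FiniteDimensional ℝ E]
    (hcard : Fintype.card κ ≤ finrank ℝ E) : Dense {f : κ → E | LinearIndependent ℝ f} := by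
  classical
  obtain ⟨e⟩ : Nonempty (κ ↪ Fin (finrank ℝ E)) :=
    Function.Embedding.nonempty_of_card_le (by simpa using hcard)
  let b := finBasis ℝ E
  let coords : E →ₗ[ℝ] κ → ℝ := LinearMap.funLeft ℝ ℝ e ∘ₗ b.equivFun.toLinearMap
  intro f
  -- In coordinates the path through `f` is `t - A`, which is singular only at eigenvalues of `A`.
  let A : Matrix κ κ ℝ := Matrix.of fun i => -coords (f i)
  let path : ℝ → κ → E := fun t i => f i + t • b (e i)
  have hindep : ∀ t ∉ spectrum ℝ A, LinearIndependent ℝ (path t) := by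
    intro t ht
    have hcoords : coords ∘ path t = (algebraMap ℝ (Matrix κ κ ℝ) t - A).row := by
      ext i j
      simp [coords, path, A, Matrix.algebraMap_matrix_apply, Finsupp.single_apply, add_comm]
    refine LinearIndependent.of_comp coords ?_
    rw [hcoords]
    exact Matrix.linearIndependent_rows_of_isUnit (spectrum.notMem_iff.mp ht)
  have hzero : (0 : ℝ) ∈ closure (spectrum ℝ A)ᶜ :=
    (A.finite_spectrum.countable.dense_compl ℝ) 0
  simpa [path] using map_mem_closure (f := path) (by fun_prop) hzero fun t ht => hindep t ht

/-- Linear general position: any at most `finrank ℝ E` members of the family are linearly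
independent. -/
def InGeneralPosition (v : ι → E) : Prop :=
  ∀ s : Finset ι, s.card ≤ finrank ℝ E → LinearIndepOn ℝ v (s : Set ι)

theorem dense_setOf_inGeneralPosition [Finite ι] [FiniteDimensional ℝ E] :
    Dense {v : ι → E | InGeneralPosition v} := by
  let indep (s : {s : Finset ι // s.card ≤ finrank ℝ E}) : Set (ι → E) :=
    LinearMap.funLeft ℝ E ((↑) : s.1 → ι) ⁻¹' {f | LinearIndependent ℝ f}
  have hopen : ∀ s, IsOpen (indep s) := fun s =>
    isOpen_setOfPred_linearIndependent.preimage (by fun_prop)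
  have hdense : ∀ s, Dense (indep s) := fun s =>
    (dense_setOf_linearIndependent (by simpa using s.2)).preimage
      (LinearMap.isOpenMap_of_finiteDimensional _
        (LinearMap.funLeft_surjective_of_injective ℝ E _ Subtype.val_injective))
  refine (dense_iInter_of_isOpen hopen hdense).mono fun v hv s hs => ?_
  exact Set.mem_iInter.mp hv ⟨s, hs⟩

variable {v : ι → E}

theorem InGeneralPosition.linearIndependent_comp [Fintype κ] (hv : InGeneralPosition v)
    {f : κ → ι} (hf : Function.Injective f) (hcard : Fintype.card κ ≤ finrank ℝ E) :
    LinearIndependent ℝ (v ∘ f) := by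
  have himage := hv (Finset.univ.map ⟨f, hf⟩) (by simpa using hcard)
  rw [Finset.coe_map] at himage
  simpa using himage.comp_of_image hf.injOn

theorem InGeneralPosition.smul_ne_smul (hv : InGeneralPosition v) (hd : 2 ≤ finrank ℝ E)
    {i j : ι} (hij : i ≠ j) {a b : ℝ} (ha : a ≠ 0) : a • v i ≠ b • v j := by
  classical
  have hpair := hv {i, j} (Finset.card_le_two.trans hd)
  rw [Finset.coe_pair, LinearIndepOn.pair_iff v hij] at hpair
  exact fun heq => ha (hpair a (-b) (by simp [heq])).1

theorem InGeneralPosition.eq_zero_of_forall_apply_eq_zero [Fintype κ] [FiniteDimensional ℝ E]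
    (hv : InGeneralPosition v) {f : κ → ι} (hf : Function.Injective f)
    (hcard : finrank ℝ E ≤ Fintype.card κ) {q : StrongDual ℝ E} (hq : ∀ i, q (v (f i)) = 0) :
    q = 0 := by
  obtain ⟨e⟩ : Nonempty (Fin (finrank ℝ E) ↪ κ) :=
    Function.Embedding.nonempty_of_card_le (by simpa using hcard)
  have hspan : Submodule.span ℝ (Set.range (v ∘ f ∘ e)) = ⊤ :=
    (hv.linearIndependent_comp (hf.comp e.injective) (by simp)).span_eq_top_of_card_eq_finrank'
      (by simp)
  refine ContinuousLinearMap.coe_injective (LinearMap.ext_on_range hspan fun i => ?_)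
  simpa using hq (e i)

/-- A minimal convex combination of members of the family that represents `0` is affinely
independent, and it is not linearly independent: it uses exactly `finrank ℝ E + 1` members. -/
theorem InGeneralPosition.exists_ncard_le_forall_exists_pos [FiniteDimensional ℝ E]
    (hv : InGeneralPosition v) {V : Set ι} (hV : (0 : E) ∈ convexHull ℝ (v '' V)) :
    ∃ S ⊆ V, S.ncard ≤ finrank ℝ E + 1 ∧
      ∀ q : StrongDual ℝ E, q ≠ 0 → ∃ i ∈ S, 0 < q (v i) := by
  obtain ⟨κ, _, z, a, hzV, hz, ha, hasum, hzero⟩ := eq_pos_convex_span_of_mem_convexHull hV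
  choose e heV hez using fun j => hzV (Set.mem_range_self j)
  have he : Function.Injective e := Function.Injective.of_comp (f := v) (by
    simpa only [Function.comp_def, hez] using hz.injective)
  have hlarge : finrank ℝ E ≤ Fintype.card κ := by
    by_contra! hsmall
    have hindep := Fintype.linearIndependent_iff.mp (hv.linearIndependent_comp he hsmall.le) a
      (by simpa only [Function.comp_apply, hez] using hzero)
    simp [hindep] at hasum
  have hcard : Fintype.card κ ≤ finrank ℝ E + 1 :=
    hz.card_le_finrank_succ.trans (by gcongr; exact Submodule.finrank_le _)
  refine ⟨Set.range e, Set.range_subset_iff.mpr heV, ?_, fun q hq => ?_⟩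
  · rwa [← Set.image_univ, Set.ncard_image_of_injective _ he, Set.ncard_univ,
      Nat.card_eq_fintype_card]
  by_contra! hle
  have hle' : ∀ j, q (v (e j)) ≤ 0 := fun j => hle _ (Set.mem_range_self j)
  have hsum : ∑ j, a j * q (v (e j)) = 0 := by
    simpa [hez] using congrArg q hzero
  have hvanish : ∀ j, q (v (e j)) = 0 := fun j => by
    have := (Finset.sum_eq_zero_iff_of_nonpos fun j _ =>
      mul_nonpos_of_nonneg_of_nonpos (ha j).le (hle' j)).mp hsum j (Finset.mem_univ j)
    exact (mul_eq_zero.mp this).resolve_left (ha j).ne'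
  exact hq (hv.eq_zero_of_forall_apply_eq_zero he hlarge hvanish)

end GeneralPosition

section SignPattern

variable {κ E : Type*} [AddCommGroup E] [Module ℝ E]

theorem dual_apply_eq_sum_repr_mul [Fintype κ] (b : Basis κ ℝ E) (f : Dual ℝ E) (x : E) :
    f x = ∑ i, b.repr x i * f (b i) := by
  conv_lhs => rw [← b.sum_repr x]
  simp only [map_sum, map_smul, smul_eq_mul]

theorem exists_ne_repr_pos [Finite κ] (b : Basis κ ℝ E) {w f : Dual ℝ E} {i : κ}
    (hw : ∀ j, 0 < w (b j)) (hfi : 0 < f (b i)) (hf : ∀ j ≠ i, f (b j) ≤ 0) {x : E}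
    (hwx : 0 < w x) (hfx : f x ≤ 0) : ∃ j ≠ i, 0 < b.repr x j := by
  cases nonempty_fintype κ
  by_contra! hle
  rcases le_or_gt (b.repr x i) 0 with hi | hi
  · have hall : ∀ j, b.repr x j ≤ 0 := fun j => by
      rcases eq_or_ne j i with rfl | hj
      exacts [hi, hle j hj]
    refine hwx.not_ge ?_
    rw [dual_apply_eq_sum_repr_mul b]
    exact Finset.sum_nonpos fun j _ => mul_nonpos_of_nonpos_of_nonneg (hall j) (hw j).le
  · refine hfx.not_gt ?_
    rw [dual_apply_eq_sum_repr_mul b]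
    refine Finset.sum_pos' (fun j _ => ?_) ⟨i, Finset.mem_univ i, mul_pos hi hfi⟩
    rcases eq_or_ne j i with rfl | hj
    exacts [(mul_pos hi hfi).le, mul_nonneg_of_nonpos_of_nonpos (hle j hj) (hf j hj)]

theorem exists_repr_neg [Finite κ] (b : Basis κ ℝ E) {q : Dual ℝ E} (hq : ∀ i, 0 < q (b i))
    {x : E} (hx : x ≠ 0) (hqx : q x ≤ 0) : ∃ i, b.repr x i < 0 := by
  cases nonempty_fintype κ
  by_contra! hnonneg
  obtain ⟨i, hi⟩ : ∃ i, b.repr x i ≠ 0 := by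
    by_contra! hzero
    exact hx (b.ext_elem fun i => by simp [hzero i])
  refine hqx.not_gt ?_
  rw [dual_apply_eq_sum_repr_mul b]
  exact Finset.sum_pos' (fun j _ => mul_nonneg (hnonneg j) (hq j).le)
    ⟨i, Finset.mem_univ i, mul_pos ((hnonneg i).lt_of_ne' hi) (hq i)⟩

theorem apply_neg_of_convex_of_forall_ne_zero {K : Set E} (hK : Convex ℝ K) {f : Dual ℝ E}
    (hf : ∀ x ∈ K, f x ≠ 0) {x y : E} (hx : x ∈ K) (hy : y ∈ K) (hfx : f x < 0) : f y < 0 := by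
  by_contra! hfy
  obtain ⟨z, hz, hfz⟩ := (hK.linear_image f).ordConnected.out
    (Set.mem_image_of_mem f hx) (Set.mem_image_of_mem f hy) ⟨hfx.le, hfy⟩
  exact hf z hz hfz

/-- By `exists_ne_repr_pos`, no coordinate of `x` is the only positive one. -/
theorem exists_repr_neg_and_repr_pos (b : Basis (Fin 3) ℝ E) {w q : Dual ℝ E}
    {g : Fin 3 → Dual ℝ E} (hw : ∀ i, 0 < w (b i)) (hq : ∀ i, 0 < q (b i))
    (hgi : ∀ i, 0 < g i (b i)) (hg : ∀ i, ∀ j ≠ i, g i (b j) ≤ 0) {x : E}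
    (hwx : 0 < w x) (hqx : q x ≤ 0) (hgx : ∀ i, g i x ≤ 0) :
    ∃ s, b.repr x s < 0 ∧ ∀ j ≠ s, 0 < b.repr x j := by
  obtain ⟨s, hs⟩ := exists_repr_neg b hq (fun h => by simp [h] at hwx) hqx
  refine ⟨s, hs, fun j hj => ?_⟩
  obtain ⟨l, hl⟩ : ∃ l, ∀ i ≠ l, i = s ∨ i = j := by
    clear * - hj
    decide +revert
  obtain ⟨i, hil, hi⟩ := exists_ne_repr_pos b hw (hgi l) (hg l) hwx (hgx l)
  obtain rfl | rfl := hl i hil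
  exacts [absurd hi hs.not_gt, hi]

/-- The coordinates do not vanish on the convex set of the vectors `x` in question, so the position
`s` of the negative coordinate does not depend on `x`. -/
theorem exists_forall_apply_nonpos (b : Basis (Fin 3) ℝ E) {w q : Dual ℝ E}
    {g : Fin 3 → Dual ℝ E} (hw : ∀ i, 0 < w (b i)) (hq : ∀ i, 0 < q (b i))
    (hgi : ∀ i, 0 < g i (b i)) (hg : ∀ i, ∀ j ≠ i, g i (b j) ≤ 0) :
    ∃ s, ∀ x, 0 < w x → q x ≤ 0 → (∀ i, g i x ≤ 0) →
      ∀ f : Dual ℝ E, 0 < f (b s) → (∀ j ≠ s, f (b j) ≤ 0) → f x ≤ 0 := by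
  let K : Set E := {x | 0 < w x ∧ q x ≤ 0 ∧ ∀ i, g i x ≤ 0}
  have hK : Convex ℝ K := by
    refine (convex_halfSpace_gt w.isLinear 0).inter ((convex_halfSpace_le q.isLinear 0).inter ?_)
    exact fun x hx y hy a c ha hc hac i =>
      convex_halfSpace_le (g i).isLinear 0 (hx i) (hy i) ha hc hac
  have hpattern : ∀ x ∈ K, ∃ s, b.repr x s < 0 ∧ ∀ j ≠ s, 0 < b.repr x j :=
    fun x hx => exists_repr_neg_and_repr_pos b hw hq hgi hg hx.1 hx.2.1 hx.2.2
  have hne : ∀ s, ∀ x ∈ K, b.coord s x ≠ 0 := fun s x hx => by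
    obtain ⟨t, hneg, hpos⟩ := hpattern x hx
    rcases eq_or_ne s t with rfl | hst
    exacts [hneg.ne, (hpos s hst).ne']
  obtain ⟨s, hs⟩ : ∃ s, ∀ x ∈ K, b.repr x s < 0 := by
    rcases K.eq_empty_or_nonempty with hempty | ⟨y, hy⟩
    · exact ⟨0, by simp [hempty]⟩
    · obtain ⟨s, hs, -⟩ := hpattern y hy
      exact ⟨s, fun x hx => apply_neg_of_convex_of_forall_ne_zero hK (hne s) hy hx hs⟩
  refine ⟨s, fun x hwx hqx hgx f hfs hf => ?_⟩
  have hx : x ∈ K := ⟨hwx, hqx, hgx⟩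
  obtain ⟨t, -, hpos⟩ := hpattern x hx
  have hst : s = t := by
    by_contra hst
    exact (hs x hx).not_gt (hpos s hst)
  subst hst
  rw [dual_apply_eq_sum_repr_mul b]
  refine Finset.sum_nonpos fun j _ => ?_
  rcases eq_or_ne j s with rfl | hj
  exacts [mul_nonpos_of_nonpos_of_nonneg (hs x hx).le hfs.le,
    mul_nonpos_of_nonneg_of_nonpos (hpos j hj).le (hf j hj)]

end SignPattern

section HalfSpace

variable {ι E : Type*} [NormedAddCommGroup E] [NormedSpace ℝ E]

/-- The indices of the vectors of the family `v` in the open linear half-space `0 < q`. -/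
def positiveSet (v : ι → E) (q : StrongDual ℝ E) : Set ι :=
  {i | 0 < q (v i)}

theorem mem_positiveSet {v : ι → E} {q : StrongDual ℝ E} {i : ι} :
    i ∈ positiveSet v q ↔ 0 < q (v i) :=
  Iff.rfl

theorem exists_lt_of_notMem_convexHull {s : Set E} (hs : s.Finite) {x : E}
    (hx : x ∉ convexHull ℝ s) : ∃ (f : StrongDual ℝ E) (c : ℝ), (∀ y ∈ s, f y < c) ∧ c < f x := by
  obtain ⟨f, c, hf, hfx⟩ :=
    geometric_hahn_banach_closed_point (convex_convexHull ℝ s) (hs.isClosed_convexHull ℝ) hx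
  exact ⟨f, c, fun y hy => hf y (subset_convexHull ℝ s hy), hfx⟩

theorem exists_extremePoint_pos {s : Set E} (hs : s.Finite) {q : StrongDual ℝ E} {x : E}
    (hx : x ∈ s) (hqx : 0 < q x) : ∃ y ∈ (convexHull ℝ s).extremePoints ℝ, 0 < q y := by
  by_contra! hle
  have hsub : convexHull ℝ s ⊆ {y | q y ≤ 0} := by
    rw [← closure_convexHull_extremePoints (hs.isCompact_convexHull ℝ) (convex_convexHull ℝ s)]
    exact closure_minimal
      (convexHull_min hle (convex_halfSpace_le q.toLinearMap.isLinear 0))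
      (isClosed_le q.continuous continuous_const)
  exact hqx.not_ge (hsub (subset_convexHull ℝ s hx))

variable {v : ι → E}

theorem exists_inter_positiveSet_subset (hv : InGeneralPosition v) (hd : finrank ℝ E = 3)
    {V : Set ι} {w q : StrongDual ℝ E} (hw : ∀ i ∈ V, 0 < w (v i)) {e : Fin 3 → ι}
    (he : Function.Injective e) (heq : ∀ i, e i ∈ V ∩ positiveSet v q)
    (hisolated : ∀ i, ∃ g, V ∩ positiveSet v g = {e i}) :
    ∃ s, ∀ f, e s ∈ positiveSet v f → (∀ j ≠ s, e j ∉ positiveSet v f) →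
      V ∩ positiveSet v f ⊆ V ∩ positiveSet v q := by
  let b := basisOfLinearIndependentOfCardEqFinrank
    (hv.linearIndependent_comp he (by simp [hd])) (by simp [hd])
  have hb : ∀ i, b i = v (e i) := fun i => by simp [b]
  choose g hg using hisolated
  have hg_pos : ∀ i, ∀ j ∈ V, 0 < g i (v j) ↔ j = e i := fun i j hj => by
    simpa [hj, mem_positiveSet] using Set.ext_iff.mp (hg i) j
  obtain ⟨s, hs⟩ := exists_forall_apply_nonpos b
    (w := w.toLinearMap) (q := q.toLinearMap) (g := fun i => (g i).toLinearMap)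
    (fun i => by simpa [hb] using hw _ (heq i).1)
    (fun i => by simpa [hb, mem_positiveSet] using (heq i).2)
    (fun i => by simpa [hb] using (hg_pos i _ (heq i).1).mpr rfl)
    (fun i j hj => by simpa [hb] using (hg_pos i _ (heq j).1).not.mpr (he.ne hj))
  refine ⟨s, fun f hfs hf i ⟨hiV, hif⟩ => ⟨hiV, ?_⟩⟩
  by_contra hiq
  have hi_ne : ∀ j, i ≠ e j := by
    rintro j rfl
    exact hiq (heq j).2
  refine hif.not_ge (hs (v i) (hw i hiV) (not_lt.mp hiq)
    (fun j => not_lt.mp ((hg_pos j i hiV).not.mpr (hi_ne j))) f.toLinearMap ?_ fun j hj => ?_)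
  · simpa [hb, mem_positiveSet] using hfs
  · simpa [hb, mem_positiveSet] using hf j hj

variable [Finite ι]

/-- Normalize `w` to `1` on the vectors of `V`; then the isolated vectors are the extreme points of
their convex hull. -/
theorem exists_inter_positiveSet_eq_singleton (hv : InGeneralPosition v) (hd : 2 ≤ finrank ℝ E)
    {V : Set ι} {w q : StrongDual ℝ E} (hw : ∀ i ∈ V, 0 < w (v i))
    (hq : (V ∩ positiveSet v q).Nonempty) :
    ∃ i ∈ V ∩ positiveSet v q, ∃ g, V ∩ positiveSet v g = {i} := by
  let u : ι → E := fun i => (w (v i))⁻¹ • v i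
  have hu : (u '' V).Finite := V.toFinite.image u
  obtain ⟨i₀, hi₀, hqi₀⟩ := hq
  obtain ⟨x, hx, hqx⟩ := exists_extremePoint_pos hu (q := q) (Set.mem_image_of_mem u hi₀)
    (by simpa [u] using mul_pos (inv_pos.mpr (hw i₀ hi₀)) hqi₀)
  obtain ⟨i, hi, rfl⟩ := extremePoints_convexHull_subset hx
  have hisolated : u i ∉ convexHull ℝ (u '' (V \ {i})) := by
    refine fun h => ((convex_convexHull ℝ _).mem_extremePoints_iff_mem_sdiff_convexHull_sdiff.mp
      hx).2 (convexHull_mono ?_ h)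
    rintro _ ⟨j, ⟨hj, hji⟩, rfl⟩
    exact ⟨subset_convexHull ℝ _ (Set.mem_image_of_mem u hj),
      hv.smul_ne_smul hd hji (inv_ne_zero (hw j hj).ne')⟩
  obtain ⟨f, c, hf, hfi⟩ := exists_lt_of_notMem_convexHull (hu.subset (by grind)) hisolated
  have hsign : ∀ j ∈ V, (f - c • w) (v j) = w (v j) * (f (u j) - c) := fun j hj => by
    have := (hw j hj).ne'
    simp [u]
    field_simp
  refine ⟨i, ⟨hi, ?_⟩, f - c • w, Set.eq_singleton_iff_unique_mem.mpr ⟨⟨hi, ?_⟩, ?_⟩⟩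
  · exact pos_of_mul_pos_right (by simpa [u] using hqx) (inv_pos.mpr (hw i hi)).le
  · rw [mem_positiveSet, hsign i hi]
    exact mul_pos (hw i hi) (sub_pos.mpr hfi)
  · rintro j ⟨hj, hjpos⟩
    by_contra hji
    rw [mem_positiveSet, hsign j hj] at hjpos
    exact (pos_of_mul_pos_right hjpos (hw j hj).le).not_gt
      (sub_neg.mpr (hf _ (Set.mem_image_of_mem u ⟨hj, hji⟩)))

theorem exists_isShallowHittingSet_two (hv : InGeneralPosition v) (hd : finrank ℝ E = 3)
    {V : Set ι} {w : StrongDual ℝ E} (hw : ∀ i ∈ V, 0 < w (v i)) {m : ℕ} (hm : 1 ≤ m) :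
    ∃ S, IsShallowHittingSet 2 (minimalTraces (Set.range (positiveSet v)) V m) S := by
  let T : Set ι := {i | ∃ g, V ∩ positiveSet v g = {i}}
  have hT : ∀ A ∈ minimalTraces (Set.range (positiveSet v)) V m, (T ∩ A).Nonempty := by
    intro A hA
    obtain ⟨⟨_, ⟨q, rfl⟩, rfl⟩, hcard⟩ := (mem_minimalTraces.mp hA).prop
    obtain ⟨i, hi, g, hg⟩ := exists_inter_positiveSet_eq_singleton hv (by omega) hw
      (Set.nonempty_of_ncard_ne_zero (Nat.one_le_iff_ne_zero.mp (hm.trans hcard)))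
    exact ⟨i, ⟨g, hg⟩, hi⟩
  obtain ⟨S, hST, hhit, hprivate⟩ := exists_subset_hitting_with_private_members hT
  refine ⟨S, fun A hA => ⟨hhit A hA, ?_⟩⟩
  by_contra! hcard
  obtain ⟨e⟩ : Nonempty (Fin 3 ↪ ↥(S ∩ A)) := by
    have := Fintype.ofFinite ↥(S ∩ A)
    refine Function.Embedding.nonempty_of_card_le ?_
    rwa [Fintype.card_fin, ← Nat.card_eq_fintype_card, Nat.card_coe_set_eq]
  have hinj : Function.Injective fun i => (e i : ι) := Subtype.val_injective.comp e.injective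
  obtain ⟨⟨_, ⟨q, rfl⟩, rfl⟩, -⟩ := (mem_minimalTraces.mp hA).prop
  obtain ⟨s, hs⟩ := exists_inter_positiveSet_subset hv hd hw hinj
    (fun i => (e i).2.2) fun i => hST (e i).2.1
  obtain ⟨A', hA', hSA'⟩ := hprivate _ (e s).2.1
  obtain ⟨⟨_, ⟨f, rfl⟩, rfl⟩, -⟩ := (mem_minimalTraces.mp hA').prop
  have honly : ∀ j, (e j : ι) ∈ positiveSet v f → j = s := fun j hj => by
    have hmem : (e j : ι) ∈ S ∩ (V ∩ positiveSet v f) := ⟨(e j).2.1, (e j).2.2.1, hj⟩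
    exact hinj (hSA'.subset hmem)
  have hsf : (e s : ι) ∈ S ∩ (V ∩ positiveSet v f) := hSA'.symm.subset rfl
  have hsub := hs f hsf.2.2 fun j hj hjf => hj (honly j hjf)
  obtain ⟨j, hj⟩ := exists_ne s
  exact hj (honly j ((mem_minimalTraces.mp hA).le_of_le
    (mem_minimalTraces.mp hA').prop hsub (e j).2.2).2)

theorem exists_isShallowHittingSet_finrank [FiniteDimensional ℝ E] (hv : InGeneralPosition v)
    {V : Set ι} (hV : (0 : E) ∈ convexHull ℝ (v '' V)) {m : ℕ} (hm : 1 ≤ m) :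
    ∃ S, IsShallowHittingSet (finrank ℝ E) (minimalTraces (Set.range (positiveSet v)) V m) S := by
  obtain ⟨S, hSV, hcard, hS⟩ := hv.exists_ncard_le_forall_exists_pos hV
  refine ⟨S, fun A hA => ?_⟩
  obtain ⟨⟨_, ⟨q, rfl⟩, rfl⟩, hmA⟩ := (mem_minimalTraces.mp hA).prop
  have hq : q ≠ 0 := by
    rintro rfl
    have hempty : V ∩ positiveSet v 0 = ∅ := by ext; simp [mem_positiveSet]
    exact hm.not_gt (by simpa [hempty] using hmA)
  obtain ⟨i, hi, hqi⟩ := hS q hq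
  obtain ⟨j, hj, hqj⟩ := hS (-q) (neg_ne_zero.mpr hq)
  refine ⟨⟨i, hi, hSV hi, hqi⟩, ?_⟩
  have hj_notMem : j ∉ S ∩ (V ∩ positiveSet v q) := fun h =>
    h.2.2.not_gt (neg_pos.mp hqj)
  exact Nat.lt_succ_iff.mp
    ((Set.ncard_lt_ncard (Set.inter_subset_left.ssubset_of_mem_notMem hj hj_notMem)).trans_le hcard)

theorem exists_isShallowHittingSet_three (hv : InGeneralPosition v) (hd : finrank ℝ E = 3)
    (V : Set ι) {m : ℕ} (hm : 1 ≤ m) :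
    ∃ S, IsShallowHittingSet 3 (minimalTraces (Set.range (positiveSet v)) V m) S := by
  by_cases hV : (0 : E) ∈ convexHull ℝ (v '' V)
  · have : FiniteDimensional ℝ E := Module.finite_of_finrank_pos (by omega)
    exact hd ▸ exists_isShallowHittingSet_finrank hv hV hm
  · obtain ⟨f, c, hf, hc⟩ := exists_lt_of_notMem_convexHull (V.toFinite.image v) hV
    have hneg : ∀ i ∈ V, 0 < (-f) (v i) := fun i hi => by
      simpa using (hf _ (Set.mem_image_of_mem v hi)).trans hc
    obtain ⟨S, hS⟩ := exists_isShallowHittingSet_two hv hd hneg hm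
    exact ⟨S, fun A hA => ⟨(hS A hA).1, (hS A hA).2.trans (by omega)⟩⟩

theorem exists_isPolychromatic_positiveSet (hv : InGeneralPosition v) (hd : finrank ℝ E = 3)
    (k : ℕ) : ∃ χ : ι → Fin (k + 1), ∀ q : StrongDual ℝ E,
      3 * k + 1 ≤ (positiveSet v q).ncard → IsPolychromatic χ (positiveSet v q) := by
  obtain ⟨χ, hχ⟩ := exists_isPolychromatic_of_isShallowHittingSet
    (fun V _ hm => exists_isShallowHittingSet_three hv hd V hm) k Set.univ
  simp only [Set.univ_inter] at hχ
  exact ⟨χ, fun q => hχ _ (Set.mem_range_self q)⟩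

end HalfSpace

section Plane

/-- Evaluation at `p` of the affine functions `x ↦ ⟪a, x⟫ + c` on the plane, encoded as pairs
`(a, c)`. Perturbing `a` and `c` makes the vectors `(a, c)` of a family of half-planes
`0 < ⟪a, x⟫ + c` linearly generic. -/
noncomputable def affineEval (p : Plane) : StrongDual ℝ (Plane × ℝ) :=
  (innerSL ℝ p).coprod (.id ℝ ℝ)

theorem affineEval_apply (p a : Plane) (c : ℝ) : affineEval p (a, c) = inner ℝ a p + c := by
  simp [affineEval, real_inner_comm]

theorem IsHalfPlane.exists_affineEval {h : Set Plane} (hh : IsHalfPlane h) {P : Set Plane}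
    (hP : P.Finite) :
    ∃ x, (∀ p ∈ P ∩ h, 0 < affineEval p x) ∧ ∀ p ∈ P \ h, affineEval p x < 0 := by
  obtain ⟨a, b, -, hab⟩ := hh
  have hsep : ∀ r ∈ P \ h, ∀ p ∈ P ∩ h, inner ℝ a r < inner ℝ a p := by
    rcases hab with rfl | rfl
    · exact fun r hr p hp => (not_le.mp hr.2).trans_le hp.2
    · exact fun r hr p hp => (not_lt.mp hr.2).trans_lt hp.2
  obtain ⟨c, hout, hin⟩ := Order.exists_between_finsets
    (hP.sdiff.image (inner ℝ a)).toFinset ((hP.inter_of_left h).image (inner ℝ a)).toFinset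
    (by simpa only [Set.Finite.mem_toFinset, Set.forall_mem_image] using hsep)
  simp only [Set.Finite.mem_toFinset, Set.forall_mem_image] at hout hin
  refine ⟨(a, -c), fun p hp => ?_, fun p hp => ?_⟩
  · rw [affineEval_apply]
    linarith [hin hp]
  · rw [affineEval_apply]
    linarith [hout hp]

/-- After moving the boundary lines off the finitely many points of `P`, a small perturbation
changes no incidence. -/
theorem exists_inGeneralPosition_affineEval {ι : Type*} [Finite ι] {h : ι → Set Plane}
    (hh : ∀ i, IsHalfPlane (h i)) {P : Set Plane} (hP : P.Finite) :
    ∃ v : ι → Plane × ℝ, InGeneralPosition v ∧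
      ∀ p ∈ P, positiveSet v (affineEval p) = {i | p ∈ h i} := by
  choose v₀ hin₀ hout₀ using fun i => (hh i).exists_affineEval hP
  let U (i : ι) : Set (Plane × ℝ) :=
    (⋂ p ∈ P ∩ h i, {x | 0 < affineEval p x}) ∩ ⋂ p ∈ P \ h i, {x | affineEval p x < 0}
  have hU : ∀ i, IsOpen (U i) := fun i =>
    ((hP.inter_of_left _).isOpen_biInter fun p _ => isOpen_lt (by fun_prop) (by fun_prop)).inter
      (hP.sdiff.isOpen_biInter fun p _ => isOpen_lt (by fun_prop) (by fun_prop))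
  obtain ⟨v, hvU, hv⟩ := dense_setOf_inGeneralPosition.inter_open_nonempty _
    (isOpen_set_pi Set.finite_univ fun i _ => hU i)
    ⟨v₀, fun i _ => ⟨Set.mem_iInter₂.mpr (hin₀ i), Set.mem_iInter₂.mpr (hout₀ i)⟩⟩
  have hin : ∀ i, ∀ p ∈ P ∩ h i, 0 < affineEval p (v i) := fun i p hp =>
    Set.biInter_subset_of_mem hp (hvU i trivial).1
  have hout : ∀ i, ∀ p ∈ P \ h i, affineEval p (v i) < 0 := fun i p hp =>
    Set.biInter_subset_of_mem hp (hvU i trivial).2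
  refine ⟨v, hv, fun p hp => Set.ext fun i => ⟨fun hi => ?_, fun hpi => hin i p ⟨hp, hpi⟩⟩⟩
  by_contra hpi
  exact (mem_positiveSet.mp hi).not_gt (hout i p ⟨hp, hpi⟩)

theorem isCoverThreshold_halfPlanes (k : ℕ) : IsCoverThreshold halfPlanes (k + 1) (3 * k + 1) := by
  intro F hF
  obtain ⟨v, hv, hcover⟩ := exists_inGeneralPosition_affineEval (fun R : F => hF R.2)
    (Set.finite_range (Set.rangeSplitting (coveringAt F)))
  obtain ⟨χ, hχ⟩ := exists_isPolychromatic_positiveSet hv (by simp) k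
  refine ⟨χ, fun p hp => ?_⟩
  let r := Set.rangeSplitting (coveringAt F) ⟨coveringAt F p, p, rfl⟩
  have hr : coveringAt F p = positiveSet v (affineEval r) := by
    rw [hcover r (Set.mem_range_self _)]
    exact (Set.apply_rangeSplitting (coveringAt F) ⟨coveringAt F p, p, rfl⟩).symm
  rw [hr] at hp ⊢
  exact hχ _ hp

end Plane

theorem theorem3 (k : ℕ) (hk : 1 ≤ k) :
    fBar halfPlanes k ≤ ((3 * k - 2 : ℕ) : ℕ∞) := by
  obtain ⟨k, rfl⟩ := Nat.exists_eq_add_of_le' hk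
  rw [fBar_le_iff, show 3 * (k + 1) - 2 = 3 * k + 1 by omega]
  exact isCoverThreshold_halfPlanes k
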